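/- Let $A=(a_{ij})_{-1\le i,j\le 8}$ be the Cartan matrix of $E_{10}$: $a_{ii}=2$, $a_{ij}=-1$ if the nodes $i\ne j$ are joined in the Dynkin diagram consisting of the chain $-1,0,1,\dots,7$ and one further node $8$ joined to node $5$, and $a_{ij}=0$ otherwise. Since $\det A=-1$, the Kac--Moody algebra $\mathfrak g=E_{10}$ is the complex Lie algebra with generators $\alpha_i^\vee,e_i,f_i$ $(-1\le i\le 8)$ and relations $$[\alpha_i^\vee,\alpha_j^\vee]=0,\quad [e_i,f_j]=\delta_{ij}\alpha_i^\vee,\quad [\alpha_i^\vee,e_j]=a_{ij}e_j,\quad [\alpha_i^\vee,f_j]=-a_{ij}f_j,$$ $$\operatorname{ad}(e_i)^{1-a_{ij}}e_j=\operatorname{ad}(f_i)^{1-a_{ij}}f_j=0\quad(i\ne j).$$ Let $\mathfrak h$ be the real span of the $\alpha_i^\vee$. Identify $\mathfrak h^*$ with $\mathbb R^{10}$, writing $\alpha=(n_1,\dots,n_{10})$, so that the simple roots, determined by $\alpha_j(\alpha_i^\vee)=a_{ij}$, are $$\alpha_{-1}=(1,-1,0,\dots,0),\ \alpha_0=(0,1,-1,0,\dots,0),\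 \dots,\ \alpha_7=(0,\dots,0,1,-1),\ \alpha_8=(0,0,0,0,0,0,0,1,1,1).$$ A root is a nonzero $\alpha\in\mathfrak h^*$ for which there is a nonzero $x\in\mathfrak g$ with $[h,x]=\alpha(h)x$ for all $h\in\mathfrak h$; it is positive if $\alpha=\sum_i k_i\alpha_i$ with all $k_i\in\mathbb Z_{\ge0}$. It is real if some element of the Weyl group (the group generated by the reflections $\lambda\mapsto\lambda-\lambda(\alpha_i^\vee)\alpha_i$ of $\mathfrak h^*$) maps it to a simple root, and imaginary otherwise. Then for every positive root $\alpha=(n_1,\dots,n_{10})$ of $E_{10}$: 1. if $\alpha$ is imaginary, then $n_i\ge 0$ for all $i$; 2. if $\alpha$ is real and $n_i<0$ for some $i$, then $(n_1,\dots,n_{10})$ is a permutation of $(1,-1,0,0,0,0,0,0,0,0)$. -/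

import Mathlib

/-! The Kac-Moody algebra of type `E₁₀`. Nodes of the Dynkin diagram are indexed by `Fin 10`, the
index `i` standing for the node usually labelled `i - 1`; thus `0, …, 8` is a chain (the nodes
`-1, 0, …, 7`) and the last index `9` (the node `8`) is attached to the index `6` (the node `5`). -/

namespace ETen

/-- The Cartan matrix of `E₁₀`. -/
def cartanMatrix : Matrix (Fin 10) (Fin 10) ℤ :=
  !![ 2, -1,  0,  0,  0,  0,  0,  0,  0,  0;
     -1,  2, -1,  0,  0,  0,  0,  0,  0,  0;
      0, -1,  2, -1,  0,  0,  0,  0,  0,  0;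
      0,  0, -1,  2, -1,  0,  0,  0,  0,  0;
      0,  0,  0, -1,  2, -1,  0,  0,  0,  0;
      0,  0,  0,  0, -1,  2, -1,  0,  0,  0;
      0,  0,  0,  0,  0, -1,  2, -1,  0, -1;
      0,  0,  0,  0,  0,  0, -1,  2, -1,  0;
      0,  0,  0,  0,  0,  0,  0, -1,  2,  0;
      0,  0,  0,  0,  0,  0, -1,  0,  0,  2]

/-- The complex Kac-Moody algebra `E₁₀`, given by Chevalley generators and Serre relations. As the
Cartan matrix is invertible, the coroots `H i` are a basis of the Cartan subalgebra, and no further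
Cartan generators are needed. -/
abbrev Algebra : Type := Matrix.ToLieAlgebra ℂ cartanMatrix

/-- The Chevalley generator `αᵢ^∨` of the Cartan subalgebra, as an element of the Lie algebra. -/
noncomputable def H (i : Fin 10) : Algebra :=
  (LieSubmodule.Quotient.mk (FreeLieAlgebra.of ℂ (CartanMatrix.Generators.H i)) :
    FreeLieAlgebra ℂ (CartanMatrix.Generators (Fin 10)) ⧸
      CartanMatrix.Relations.toIdeal ℂ cartanMatrix)

/-- The dual of the (real) Cartan subalgebra in the physical basis: `α = (n₁, …, n₁₀)`. -/
abbrev CartanDual : Type := Fin 10 → ℝ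

/-- The simple roots in the physical basis. -/
def simpleRoot : Fin 10 → CartanDual :=
  ![![1, -1, 0, 0, 0, 0, 0, 0, 0, 0],
    ![0, 1, -1, 0, 0, 0, 0, 0, 0, 0],
    ![0, 0, 1, -1, 0, 0, 0, 0, 0, 0],
    ![0, 0, 0, 1, -1, 0, 0, 0, 0, 0],
    ![0, 0, 0, 0, 1, -1, 0, 0, 0, 0],
    ![0, 0, 0, 0, 0, 1, -1, 0, 0, 0],
    ![0, 0, 0, 0, 0, 0, 1, -1, 0, 0],
    ![0, 0, 0, 0, 0, 0, 0, 1, -1, 0],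
    ![0, 0, 0, 0, 0, 0, 0, 0, 1, -1],
    ![0, 0, 0, 0, 0, 0, 0, 1, 1, 1]]

/-- The components `(h₁, …, h₁₀)` of the simple coroots in the physical basis of the Cartan
subalgebra, the one dual to the physical basis of `CartanDual`. -/
noncomputable def corootVec : Fin 10 → (Fin 10 → ℝ) :=
  ![![1, -1, 0, 0, 0, 0, 0, 0, 0, 0],
    ![0, 1, -1, 0, 0, 0, 0, 0, 0, 0],
    ![0, 0, 1, -1, 0, 0, 0, 0, 0, 0],
    ![0, 0, 0, 1, -1, 0, 0, 0, 0, 0],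
    ![0, 0, 0, 0, 1, -1, 0, 0, 0, 0],
    ![0, 0, 0, 0, 0, 1, -1, 0, 0, 0],
    ![0, 0, 0, 0, 0, 0, 1, -1, 0, 0],
    ![0, 0, 0, 0, 0, 0, 0, 1, -1, 0],
    ![0, 0, 0, 0, 0, 0, 0, 0, 1, -1],
    ![-1/3, -1/3, -1/3, -1/3, -1/3, -1/3, -1/3, 2/3, 2/3, 2/3]]

/-- The simple coroot `αᵢ^∨` as the functional `α ↦ α(αᵢ^∨)`. -/
noncomputable def coroot (i : Fin 10) : Module.Dual ℝ CartanDual :=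
  dotProductEquiv ℝ (Fin 10) (corootVec i)

/-- `αⱼ(αᵢ^∨) = aᵢⱼ`. -/
theorem coroot_simpleRoot (i j : Fin 10) :
    coroot i (simpleRoot j) = (cartanMatrix i j : ℝ) := by
  fin_cases i <;> fin_cases j <;>
    norm_num [coroot, corootVec, simpleRoot, cartanMatrix, dotProduct, Fin.sum_univ_succ, Fin.succ,
      Matrix.cons_val]

theorem coroot_simpleRoot_self (i : Fin 10) : coroot i (simpleRoot i) = 2 := by
  rw [coroot_simpleRoot]
  fin_cases i <;> norm_num [cartanMatrix, Matrix.cons_val]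

/-- `α` is a root: `α ≠ 0`, and the root space `{x | [h, x] = α(h) x for all h}` is nonzero (the
condition is linear in `h`, so it is tested on the coroots, which span the Cartan subalgebra). -/
def IsRoot (α : CartanDual) : Prop :=
  α ≠ 0 ∧ ∃ x : Algebra, x ≠ 0 ∧ ∀ i, ⁅H i, x⁆ = ((coroot i α : ℝ) : ℂ) • x

/-- A positive root: a root that is a combination of simple roots with coefficients in `ℕ`. -/
def IsPositiveRoot (α : CartanDual) : Prop :=
  IsRoot α ∧ ∃ k : Fin 10 → ℕ, α = ∑ i, (k i : ℝ) • simpleRoot i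

/-- The simple reflection `λ ↦ λ - λ(αᵢ^∨) αᵢ`. -/
noncomputable def simpleReflection (i : Fin 10) : CartanDual ≃ₗ[ℝ] CartanDual :=
  Module.reflection (coroot_simpleRoot_self i)

/-- The Weyl group, generated by the simple reflections. -/
noncomputable def weylGroup : Subgroup (CartanDual ≃ₗ[ℝ] CartanDual) :=
  Subgroup.closure (Set.range simpleReflection)

/-- A real root: a root that some Weyl group element maps to a simple root. -/
def IsRealRoot (α : CartanDual) : Prop :=
  IsRoot α ∧ ∃ w ∈ weylGroup, ∃ i, w α = simpleRoot i

/-- An imaginary root: a root that is not real. -/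
def IsImaginaryRoot (α : CartanDual) : Prop :=
  IsRoot α ∧ ¬ IsRealRoot α

end ETen

/-! Three facts about roots suffice. Every root is, up to sign, a combination of simple roots with
natural coefficients, and a multiple of a simple root is a root only for the factor `±1`
(`IsRoot.exists_eq_sum`, from the triangular decomposition). Simple reflections preserve roots
(`IsRoot.simpleReflection`, from `𝔰𝔩₂`-theory). The first nine reflections generate all permutations
of the ten coordinates.

The partial sums `α 0`, `α 0 + α 1`, `α 0 + α 1 + α 2` and a third of the total are coefficients of
`α`, so they share a sign; by permuting, this holds for any three distinct positions. Let `α` be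
positive with `α p < 0`. Putting `p` first makes the total nonpositive, hence zero by positivity, so
some `α q > 0`. Comparing the orders `q, p, l` and `p, q, l` forces `α p + α q = 0` and `α l = 0`
for every other `l`. Thus `α` is a permuted positive multiple of the first simple root, and the
factor is `1`. Such a root is real, so both claims follow at once. -/

/-! ### Chevalley generators and iterated brackets -/

/-- Elements `h i`, `e i`, `f i` generating a Lie algebra and satisfying the Chevalley-Serre
relations of the integer matrix `A`. -/
structure IsChevalleySystem (R : Type*) {ι L : Type*} [CommRing R] [LieRing L] [LieAlgebra R L]
    [DecidableEq ι] (A : Matrix ι ι ℤ) (h e f : ι → L) : Prop where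
  lie_h_h : ∀ i j, ⁅h i, h j⁆ = 0
  lie_e_f : ∀ i j, ⁅e i, f j⁆ = if i = j then h i else 0
  lie_h_e : ∀ i j, ⁅h i, e j⁆ = (A i j : R) • e j
  lie_h_f : ∀ i j, ⁅h i, f j⁆ = -((A i j : R) • f j)
  serre_e : ∀ i j, ∃ n : ℕ, (LieAlgebra.ad R L (e i) ^ n) (e j) = 0
  serre_f : ∀ i j, ∃ n : ℕ, (LieAlgebra.ad R L (f i) ^ n) (f j) = 0
  eq_top_of_mem : ∀ K : LieSubalgebra R L,
    (∀ i, h i ∈ K) → (∀ i, e i ∈ K) → (∀ i, f i ∈ K) → K = ⊤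

/-- Iterated brackets `⁅e i₁, ⁅e i₂, …⁆⁆`, together with the multiplicities of the indices. -/
inductive IsLieMonomial {ι L : Type*} [LieRing L] [DecidableEq ι] (e : ι → L) :
    (ι → ℕ) → L → Prop
  | simple (i : ι) : IsLieMonomial e (Pi.single i 1) (e i)
  | lie (i : ι) (k : ι → ℕ) (y : L) (hy : IsLieMonomial e k y) :
      IsLieMonomial e (k + Pi.single i 1) ⁅e i, y⁆

namespace IsLieMonomial

variable {ι L : Type*} [LieRing L] [DecidableEq ι] {e : ι → L} {k : ι → ℕ} {y : L}

/-- A nonzero iterated bracket either is a generator or involves two different generators. -/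
theorem eq_zero_or_simple_or_mixed (hy : IsLieMonomial e k y) :
    y = 0 ∨ (∃ j, k = Pi.single j 1 ∧ y = e j) ∨ ∃ i j, i ≠ j ∧ k i ≠ 0 ∧ k j ≠ 0 := by
  induction hy with
  | simple i => exact Or.inr (Or.inl ⟨i, rfl, rfl⟩)
  | lie i k y hy ih =>
    rcases ih with rfl | ⟨j, rfl, rfl⟩ | ⟨a, b, hab, ha, hb⟩
    · simp
    · by_cases hij : i = j
      · subst hij; simp
      · exact Or.inr (Or.inr ⟨i, j, hij, by simp, by simp⟩)
    · exact Or.inr (Or.inr ⟨a, b, hab, by simp [ha], by simp [hb]⟩)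

end IsLieMonomial

namespace IsChevalleySystem

section CommRing

variable {R ι L : Type*} [CommRing R] [LieRing L] [LieAlgebra R L] [DecidableEq ι]
  {A : Matrix ι ι ℤ} {h e f : ι → L}

/-- The Chevalley involution: each result about the `e i` also yields its mirror image for the `f
i`. -/
theorem symm (S : IsChevalleySystem R A h e f) : IsChevalleySystem R A (-h) f e where
  lie_h_h i j := by simp [S.lie_h_h]
  lie_e_f i j := by
    rw [← lie_skew, S.lie_e_f]
    by_cases hij : i = j
    · subst hij; simp
    · simp [hij, Ne.symm hij]
  lie_h_e i j := by simp [S.lie_h_f]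
  lie_h_f i j := by simp [S.lie_h_e]
  serre_e := S.serre_f
  serre_f := S.serre_e
  eq_top_of_mem K hh he hf :=
    S.eq_top_of_mem K (fun i => by simpa using K.neg_mem (hh i)) hf he

/-- The operators `ad (e i)` are locally nilpotent. -/
theorem exists_ad_e_pow_eq_zero (S : IsChevalleySystem R A h e f) (i : ι) (x : L) :
    ∃ n : ℕ, (LieAlgebra.ad R L (e i) ^ n) x = 0 := by
  have hn (j : ι) : (LieAlgebra.ad R L (e i) ^ 2) (h j) = 0 := by
    rw [pow_two, Module.End.mul_apply, LieAlgebra.ad_apply, LieAlgebra.ad_apply,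
      ← lie_skew (e i) (h j), S.lie_h_e]
    simp
  -- The Engel set is closed under brackets, so local nilpotency need only be checked on generators.
  have htop : LieSubalgebra.engel R (e i) = ⊤ := by
    refine S.eq_top_of_mem _ (fun j => ?_) (fun j => ?_) (fun j => ?_) <;>
      rw [LieSubalgebra.mem_engel_iff]
    · exact ⟨2, hn j⟩
    · exact S.serre_e i j
    · refine ⟨3, ?_⟩
      rw [pow_succ, Module.End.mul_apply, LieAlgebra.ad_apply, S.lie_e_f]
      split_ifs
      · exact hn i
      · simp
  have hx : x ∈ LieSubalgebra.engel R (e i) := htop ▸ LieSubalgebra.mem_top (R := R) x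
  exact (LieSubalgebra.mem_engel_iff R _ _).1 hx

/-- A subspace that contains the generators and is stable under them is everything. -/
theorem submodule_eq_top (S : IsChevalleySystem R A h e f) (M : Submodule R L)
    (hh : ∀ i, h i ∈ M) (he : ∀ i, e i ∈ M) (hf : ∀ i, f i ∈ M)
    (lh : ∀ i, ∀ y ∈ M, ⁅h i, y⁆ ∈ M) (le : ∀ i, ∀ y ∈ M, ⁅e i, y⁆ ∈ M)
    (lf : ∀ i, ∀ y ∈ M, ⁅f i, y⁆ ∈ M) : M = ⊤ := by
  -- The elements whose adjoint action preserves `M` form a subalgebra; it contains the generators,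
  -- so `M` is an ideal, hence itself a subalgebra containing them.
  let K : LieSubalgebra R L :=
    { carrier := {x | ∀ y ∈ M, ⁅x, y⁆ ∈ M}
      add_mem' := fun {a b} ha hb y hy => by
        rw [add_lie]; exact M.add_mem (ha y hy) (hb y hy)
      zero_mem' := fun y _ => by simp
      smul_mem' := fun c x hx y hy => by
        rw [smul_lie]; exact M.smul_mem c (hx y hy)
      lie_mem' := fun {a b} ha hb y hy => by
        rw [lie_lie]; exact M.sub_mem (ha _ (hb y hy)) (hb _ (ha y hy)) }
  have hK : K = ⊤ := S.eq_top_of_mem K lh le lf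
  have hM : ∀ x y, y ∈ M → ⁅x, y⁆ ∈ M := fun x y hy => by
    have hx : x ∈ K := hK ▸ LieSubalgebra.mem_top (R := R) x
    exact hx y hy
  let N : LieSubalgebra R L := { M with lie_mem' := fun {a b} _ hb => hM a b hb }
  have hN : N = ⊤ := S.eq_top_of_mem N hh he hf
  refine eq_top_iff.2 fun x _ => ?_
  have hx : x ∈ N := hN ▸ LieSubalgebra.mem_top (R := R) x
  exact hx

end CommRing

/-! ### Triangular decomposition -/

section Decomposition

variable {R ι L : Type*} [CommRing R] [LieRing L] [LieAlgebra R L] [DecidableEq ι]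
  {A : Matrix ι ι ℤ} {h e f : ι → L}

theorem lie_h_of_isLieMonomial [Fintype ι] (S : IsChevalleySystem R A h e f) {k : ι → ℕ} {y : L}
    (hy : IsLieMonomial e k y) (i : ι) : ⁅h i, y⁆ = (∑ j, (k j : R) * (A i j : R)) • y := by
  induction hy with
  | simple j =>
    rw [S.lie_h_e]
    simp [Pi.single_apply]
  | lie j k y hy ih =>
    rw [leibniz_lie, ih, S.lie_h_e, smul_lie, lie_smul, ← add_smul]
    congr 1
    simp [Pi.single_apply, add_mul, Finset.sum_add_distrib, add_comm]

/-- The span of the iterated brackets of the `e i`. -/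
def monomialSpan (R : Type*) {ι L : Type*} [CommRing R] [LieRing L] [LieAlgebra R L]
    [DecidableEq ι] (e : ι → L) : Submodule R L :=
  Submodule.span R {y | ∃ k, IsLieMonomial e k y}

theorem lie_e_mem_monomialSpan (i : ι) {y : L} (hy : y ∈ monomialSpan R e) :
    ⁅e i, y⁆ ∈ monomialSpan R e := by
  induction hy using Submodule.span_induction with
  | mem y hy =>
    obtain ⟨k, hy⟩ := hy
    exact Submodule.subset_span ⟨_, hy.lie i⟩
  | zero => simp
  | add a b _ _ ha hb => rw [lie_add]; exact Submodule.add_mem _ ha hb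
  | smul c a _ ha => rw [lie_smul]; exact Submodule.smul_mem _ _ ha

theorem e_mem_monomialSpan (i : ι) : e i ∈ monomialSpan R e :=
  Submodule.subset_span ⟨_, .simple i⟩

theorem lie_e_mem_of_mem_span_h (S : IsChevalleySystem R A h e f) (i : ι) {y : L}
    (hy : y ∈ Submodule.span R (Set.range h)) : ⁅e i, y⁆ ∈ monomialSpan R e := by
  induction hy using Submodule.span_induction with
  | mem y hy =>
    obtain ⟨j, rfl⟩ := hy
    rw [← lie_skew, S.lie_h_e]
    exact Submodule.neg_mem _ (Submodule.smul_mem _ _ (e_mem_monomialSpan i))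
  | zero => simp
  | add a b _ _ ha hb => rw [lie_add]; exact Submodule.add_mem _ ha hb
  | smul c a _ ha => rw [lie_smul]; exact Submodule.smul_mem _ _ ha

theorem lie_h_mem_monomialSpan [Fintype ι] (S : IsChevalleySystem R A h e f) (i : ι) {y : L}
    (hy : y ∈ monomialSpan R e) : ⁅h i, y⁆ ∈ monomialSpan R e := by
  induction hy using Submodule.span_induction with
  | mem y hy =>
    obtain ⟨k, hy⟩ := hy
    rw [S.lie_h_of_isLieMonomial hy]
    exact Submodule.smul_mem _ _ (Submodule.subset_span ⟨k, hy⟩)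
  | zero => simp
  | add a b _ _ ha hb => rw [lie_add]; exact Submodule.add_mem _ ha hb
  | smul c a _ ha => rw [lie_smul]; exact Submodule.smul_mem _ _ ha

theorem lie_f_mem_of_mem_monomialSpan [Fintype ι] (S : IsChevalleySystem R A h e f) (j : ι) {y : L}
    (hy : y ∈ monomialSpan R e) :
    ⁅f j, y⁆ ∈ Submodule.span R (Set.range h) ⊔ monomialSpan R e := by
  have hfe (i : ι) : ⁅f j, e i⁆ = if i = j then -h i else 0 := by
    rw [← lie_skew, S.lie_e_f]
    split_ifs <;> simp
  induction hy using Submodule.span_induction with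
  | mem y hy =>
    obtain ⟨k, hy⟩ := hy
    induction hy with
    | simple i =>
      rw [hfe]
      split_ifs
      · exact Submodule.neg_mem _ (Submodule.mem_sup_left (Submodule.subset_span ⟨i, rfl⟩))
      · exact Submodule.zero_mem _
    | lie i k y hy ih =>
      rw [leibniz_lie, hfe]
      refine Submodule.add_mem _ ?_ (Submodule.mem_sup_right ?_)
      · split_ifs
        · rw [neg_lie]
          exact Submodule.neg_mem _ (Submodule.mem_sup_right
            (S.lie_h_mem_monomialSpan i (Submodule.subset_span ⟨k, hy⟩)))
        · simp
      · obtain ⟨a, ha, b, hb, hab⟩ := Submodule.mem_sup.1 ih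
        rw [← hab, lie_add]
        exact Submodule.add_mem _ (S.lie_e_mem_of_mem_span_h i ha) (lie_e_mem_monomialSpan i hb)
  | zero => simp
  | add a b _ _ ha hb => rw [lie_add]; exact Submodule.add_mem _ ha hb
  | smul c a _ ha => rw [lie_smul]; exact Submodule.smul_mem _ _ ha

theorem span_range_neg {R ι L : Type*} [CommRing R] [AddCommGroup L] [Module R L] (h : ι → L) :
    Submodule.span R (Set.range (-h)) = Submodule.span R (Set.range h) := by
  rw [show Set.range (-h) = -Set.range h by ext x; simp [neg_eq_iff_eq_neg], Submodule.span_neg]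

/-- The triangular decomposition, as a statement about spans. -/
theorem sup_monomialSpan_eq_top [Fintype ι] (S : IsChevalleySystem R A h e f) :
    Submodule.span R (Set.range h) ⊔ monomialSpan R e ⊔ monomialSpan R f = ⊤ := by
  set T := Submodule.span R (Set.range h) with hT
  have hTe : T ⊔ monomialSpan R e ≤ T ⊔ monomialSpan R e ⊔ monomialSpan R f := le_sup_left
  have hTf : T ⊔ monomialSpan R f ≤ T ⊔ monomialSpan R e ⊔ monomialSpan R f :=
    sup_le_sup_right le_sup_left _
  have key : ∀ z : L, (∀ y ∈ T, ⁅z, y⁆ ∈ T ⊔ monomialSpan R e ⊔ monomialSpan R f) →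
      (∀ y ∈ monomialSpan R e, ⁅z, y⁆ ∈ T ⊔ monomialSpan R e ⊔ monomialSpan R f) →
      (∀ y ∈ monomialSpan R f, ⁅z, y⁆ ∈ T ⊔ monomialSpan R e ⊔ monomialSpan R f) →
      ∀ y ∈ T ⊔ monomialSpan R e ⊔ monomialSpan R f,
        ⁅z, y⁆ ∈ T ⊔ monomialSpan R e ⊔ monomialSpan R f := by
    intro z h1 h2 h3 y hy
    obtain ⟨u, hu, c, hc, rfl⟩ := Submodule.mem_sup.1 hy
    obtain ⟨a, ha, b, hb, rfl⟩ := Submodule.mem_sup.1 hu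
    rw [lie_add, lie_add]
    exact Submodule.add_mem _ (Submodule.add_mem _ (h1 a ha) (h2 b hb)) (h3 c hc)
  refine S.submodule_eq_top _
    (fun i => hTe (Submodule.mem_sup_left (Submodule.subset_span ⟨i, rfl⟩)))
    (fun i => hTe (Submodule.mem_sup_right (e_mem_monomialSpan i)))
    (fun i => Submodule.mem_sup_right (e_mem_monomialSpan i)) (fun i => ?_) (fun i => ?_)
    (fun i => ?_)
  · refine key _ (fun y hy => ?_) (fun y hy => ?_) (fun y hy => ?_)
    · have : ⁅h i, y⁆ = 0 := by
        induction hy using Submodule.span_induction with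
        | mem y hy => obtain ⟨j, rfl⟩ := hy; exact S.lie_h_h i j
        | zero => simp
        | add a b _ _ ha hb => rw [lie_add, ha, hb, add_zero]
        | smul c a _ ha => rw [lie_smul, ha, smul_zero]
      rw [this]; exact Submodule.zero_mem _
    · exact hTe (Submodule.mem_sup_right (S.lie_h_mem_monomialSpan i hy))
    · have := S.symm.lie_h_mem_monomialSpan i hy
      rw [Pi.neg_apply, neg_lie, Submodule.neg_mem_iff] at this
      exact Submodule.mem_sup_right this
  · refine key _ (fun y hy => ?_) (fun y hy => ?_) (fun y hy => ?_)
    · exact hTe (Submodule.mem_sup_right (S.lie_e_mem_of_mem_span_h i hy))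
    · exact hTe (Submodule.mem_sup_right (lie_e_mem_monomialSpan i hy))
    · have := S.symm.lie_f_mem_of_mem_monomialSpan i hy
      rw [span_range_neg] at this
      exact hTf this
  · refine key _ (fun y hy => ?_) (fun y hy => ?_) (fun y hy => ?_)
    · exact Submodule.mem_sup_right (S.symm.lie_e_mem_of_mem_span_h i (by rwa [span_range_neg]))
    · exact hTe (S.lie_f_mem_of_mem_monomialSpan i hy)
    · exact Submodule.mem_sup_right (lie_e_mem_monomialSpan i hy)

end Decomposition

/-! ### Weights of the adjoint representation -/

section Field

variable {𝕜 ι L : Type*} [Field 𝕜] [LieRing L] [LieAlgebra 𝕜 L] [DecidableEq ι] [Fintype ι]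
  {A : Matrix ι ι ℤ} {h e f : ι → L}

/-- A nonzero weight of the adjoint representation is, up to sign, a combination of simple roots
with natural coefficients, and is simple if it is a multiple of a simple root. -/
theorem exists_eq_sum_of_weight (S : IsChevalleySystem 𝕜 A h e f) {χ : ι → 𝕜} (hχ : χ ≠ 0)
    {x : L} (hx0 : x ≠ 0) (hx : ∀ i, ⁅h i, x⁆ = χ i • x) :
    ∃ k : ι → ℕ, ((∃ j, k = Pi.single j 1) ∨ ∃ i j, i ≠ j ∧ k i ≠ 0 ∧ k j ≠ 0) ∧
      ((∀ i, χ i = ∑ j, (k j : 𝕜) * (A i j : 𝕜)) ∨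
        ∀ i, χ i = -∑ j, (k j : 𝕜) * (A i j : 𝕜)) := by
  by_contra! hcon
  -- Simultaneous weight spaces are independent. If `χ` had none of the listed forms, the spaces
  -- with weight other than `χ` would already span `L`, leaving no room for `x`.
  let V (μ : ι → 𝕜) : Submodule 𝕜 L :=
    ⨅ i, (LieAlgebra.ad 𝕜 L (h i)).maxGenEigenspace (μ i)
  have hV {μ : ι → 𝕜} {y : L} (hy : ∀ i, ⁅h i, y⁆ = μ i • y) : y ∈ V μ := by
    refine (Submodule.mem_iInf _).2 fun i => ?_
    refine (Module.End.genEigenspace _ _).mono (OrderTop.le_top 1) ?_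
    exact Module.End.mem_eigenspace_iff.2 (hy i)
  have hind : iSupIndep V := by
    refine Module.End.independent_iInf_maxGenEigenspace_of_forall_mapsTo _ fun i j φ => ?_
    refine Module.End.mapsTo_maxGenEigenspace_of_comm ?_ φ
    refine LinearMap.ext fun y => ?_
    simp only [Module.End.mul_apply, LieAlgebra.ad_apply]
    rw [leibniz_lie, S.lie_h_h, zero_lie, zero_add]
  have hlift {μ : ι → 𝕜} (hμ : μ ≠ χ) {y : L} (hy : ∀ i, ⁅h i, y⁆ = μ i • y) :
      y ∈ ⨆ (ν) (_ : ν ≠ χ), V ν :=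
    Submodule.mem_iSup_of_mem μ (Submodule.mem_iSup_of_mem hμ (hV hy))
  have htop : ⨆ (μ) (_ : μ ≠ χ), V μ = ⊤ := by
    rw [eq_top_iff, ← S.sup_monomialSpan_eq_top]
    refine sup_le (sup_le ?_ ?_) ?_
    · refine Submodule.span_le.2 ?_
      rintro _ ⟨j, rfl⟩
      exact hlift hχ.symm fun i => by simp [S.lie_h_h]
    · refine Submodule.span_le.2 ?_
      rintro y ⟨k, hy⟩
      rcases hy.eq_zero_or_simple_or_mixed with rfl | ⟨j, hj, -⟩ | hk
      · exact Submodule.zero_mem _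
      · obtain ⟨i, hi⟩ := (hcon k (Or.inl ⟨j, hj⟩)).1
        exact hlift (fun hc => hi (congrFun hc i).symm) (S.lie_h_of_isLieMonomial hy)
      · obtain ⟨i, hi⟩ := (hcon k (Or.inr hk)).1
        exact hlift (fun hc => hi (congrFun hc i).symm) (S.lie_h_of_isLieMonomial hy)
    · refine Submodule.span_le.2 ?_
      rintro y ⟨k, hy⟩
      have hy' (i : ι) : ⁅h i, y⁆ = (-∑ j, (k j : 𝕜) * (A i j : 𝕜)) • y := by
        have := S.symm.lie_h_of_isLieMonomial hy i
        rw [Pi.neg_apply, neg_lie, neg_eq_iff_eq_neg] at this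
        rw [this, neg_smul]
      rcases hy.eq_zero_or_simple_or_mixed with rfl | ⟨j, hj, -⟩ | hk
      · exact Submodule.zero_mem _
      · obtain ⟨i, hi⟩ := (hcon k (Or.inl ⟨j, hj⟩)).2
        exact hlift (fun hc => hi (congrFun hc i).symm) hy'
      · obtain ⟨i, hi⟩ := (hcon k (Or.inr hk)).2
        exact hlift (fun hc => hi (congrFun hc i).symm) hy'
  have hdis := hind χ
  rw [htop, disjoint_top] at hdis
  exact hx0 ((Submodule.mem_bot 𝕜).1 (hdis ▸ hV hx))

end Field

end IsChevalleySystem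

/-! ### Representations of `𝔰𝔩₂` -/

section SlTwo

variable {𝕜 L : Type*} [Field 𝕜] [LieRing L] [LieAlgebra 𝕜 L] {h e f x : L} {μ : 𝕜}

theorem lie_ad_pow_of_lie_eq_smul {g : L} {c : 𝕜} (hg : ⁅h, g⁆ = c • g) (hx : ⁅h, x⁆ = μ • x)
    (n : ℕ) : ⁅h, (LieAlgebra.ad 𝕜 L g ^ n) x⁆ = (μ + n * c) • (LieAlgebra.ad 𝕜 L g ^ n) x := by
  induction n with
  | zero => simpa using hx
  | succ n ih =>
    rw [pow_succ', Module.End.mul_apply, LieAlgebra.ad_apply, leibniz_lie, hg, ih, smul_lie,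
      lie_smul, ← add_smul]
    congr 1
    push_cast
    ring

theorem lie_e_ad_f_pow_succ (hf : ⁅h, f⁆ = (-2 : 𝕜) • f) (hef : ⁅e, f⁆ = h)
    (hx : ⁅h, x⁆ = μ • x) (n : ℕ) :
    ⁅e, (LieAlgebra.ad 𝕜 L f ^ (n + 1)) x⁆ = (LieAlgebra.ad 𝕜 L f ^ (n + 1)) ⁅e, x⁆ +
      ((n + 1) * (μ - n)) • (LieAlgebra.ad 𝕜 L f ^ n) x := by
  induction n with
  | zero => simp [leibniz_lie e f x, hef, hx, add_comm]
  | succ n ih =>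
    have hp (n : ℕ) (y : L) : (LieAlgebra.ad 𝕜 L f ^ (n + 1)) y =
        ⁅f, (LieAlgebra.ad 𝕜 L f ^ n) y⁆ := by
      rw [pow_succ', Module.End.mul_apply, LieAlgebra.ad_apply]
    rw [hp (n + 1) x, hp (n + 1) ⁅e, x⁆, leibniz_lie, hef, ih, lie_ad_pow_of_lie_eq_smul hf hx,
      lie_add, lie_smul, ← hp n x, add_left_comm, ← add_smul]
    congr 2
    push_cast
    ring

/-- In an `𝔰𝔩₂`-module on which `e` is locally nilpotent, `f ^ m` is injective on the weight space
of weight `m`. -/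
theorem eq_zero_of_ad_f_pow_eq_zero [CharZero 𝕜] (he : ⁅h, e⁆ = (2 : 𝕜) • e)
    (hf : ⁅h, f⁆ = (-2 : 𝕜) • f) (hef : ⁅e, f⁆ = h) (N m : ℕ) (x : L)
    (hx : ⁅h, x⁆ = (m : 𝕜) • x) (hN : (LieAlgebra.ad 𝕜 L e ^ N) x = 0)
    (hm : (LieAlgebra.ad 𝕜 L f ^ m) x = 0) : x = 0 := by
  induction N generalizing m x with
  | zero => simpa using hN
  | succ N ih =>
    have hm1 : (LieAlgebra.ad 𝕜 L f ^ (m + 1)) x = 0 := by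
      rw [pow_succ', Module.End.mul_apply, hm, map_zero]
    have hm2 : (LieAlgebra.ad 𝕜 L f ^ (m + 1 + 1)) x = 0 := by
      rw [pow_succ', Module.End.mul_apply, hm1, map_zero]
    -- `⁅e, x⁆` has weight `m + 2`, is killed by one power of `e` fewer, and by `f ^ (m + 2)`
    -- through the commutation formula, so induction on `N` applies.
    have hex : ⁅e, x⁆ = 0 := by
      refine ih (m + 2) _ ?_ ?_ ?_
      · rw [leibniz_lie, he, hx, smul_lie, lie_smul, ← add_smul]
        congr 1
        push_cast
        ring
      · rwa [pow_succ, Module.End.mul_apply, LieAlgebra.ad_apply] at hN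
      · have := lie_e_ad_f_pow_succ hf hef hx (m + 1)
        rw [hm1, hm2, lie_zero, smul_zero, add_zero] at this
        exact this.symm
    -- Now `x` is a highest weight vector, and the factor `(j + 1) * (m - j)` is nonzero for `j <
    -- m`, so vanishing descends from `f ^ m` to `f ^ 0`.
    have hdown : ∀ j : ℕ, j ≤ m → (LieAlgebra.ad 𝕜 L f ^ j) x = 0 → x = 0 := by
      intro j
      induction j with
      | zero => intro _ h0; simpa using h0
      | succ j ihj =>
        intro hj h0
        refine ihj (by omega) ?_
        have := lie_e_ad_f_pow_succ hf hef hx j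
        rw [h0, hex, lie_zero, map_zero, zero_add] at this
        refine (smul_eq_zero.1 this.symm).resolve_left (mul_ne_zero (by exact_mod_cast j.succ_ne_zero) ?_)
        rw [sub_ne_zero]
        exact_mod_cast (by omega : m ≠ j)
    exact hdown m le_rfl hm

end SlTwo

/-! ### Reflections of weights -/

namespace IsChevalleySystem

variable {𝕜 ι L : Type*} [Field 𝕜] [CharZero 𝕜] [LieRing L] [LieAlgebra 𝕜 L] [DecidableEq ι]
  {A : Matrix ι ι ℤ} {h e f : ι → L}

/-- The vector is `f i` applied `m` times to `x`; it is nonzero because `e i` acts locally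
nilpotently. -/
theorem exists_weight_sub (S : IsChevalleySystem 𝕜 A h e f) {i : ι} (hA : A i i = 2)
    {χ : ι → 𝕜} {x : L} (hx0 : x ≠ 0) (hx : ∀ j, ⁅h j, x⁆ = χ j • x) {m : ℕ} (hm : χ i = m) :
    ∃ y : L, y ≠ 0 ∧ ∀ j, ⁅h j, y⁆ = (χ j - m * A j i) • y := by
  refine ⟨(LieAlgebra.ad 𝕜 L (f i) ^ m) x, fun h0 => hx0 ?_, fun j => ?_⟩
  · obtain ⟨N, hN⟩ := S.exists_ad_e_pow_eq_zero i x
    refine eq_zero_of_ad_f_pow_eq_zero (h := h i) ?_ ?_ ?_ N m x (hm ▸ hx i) hN h0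
    · rw [S.lie_h_e, hA]; norm_cast
    · rw [S.lie_h_f, hA, neg_smul]; norm_cast
    · rw [S.lie_e_f, if_pos rfl]
  · rw [lie_ad_pow_of_lie_eq_smul (c := -(A j i : 𝕜)) (by rw [S.lie_h_f, neg_smul]) (hx j),
      mul_neg, sub_eq_add_neg]

/-- The simple reflections permute the integral weights of the adjoint representation. -/
theorem exists_weight_reflection (S : IsChevalleySystem 𝕜 A h e f) {i : ι} (hA : A i i = 2)
    {χ : ι → 𝕜} {x : L} (hx0 : x ≠ 0) (hx : ∀ j, ⁅h j, x⁆ = χ j • x) {z : ℤ} (hz : χ i = z) :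
    ∃ y : L, y ≠ 0 ∧ ∀ j, ⁅h j, y⁆ = (χ j - χ i * A j i) • y := by
  obtain ⟨m, rfl | rfl⟩ := z.eq_nat_or_neg
  · obtain ⟨y, hy0, hy⟩ := S.exists_weight_sub hA hx0 hx (m := m) (by simpa using hz)
    exact ⟨y, hy0, fun j => by rw [hy, hz, Int.cast_natCast]⟩
  · obtain ⟨y, hy0, hy⟩ := S.symm.exists_weight_sub (χ := -χ) hA hx0
      (fun j => by simp [hx j]) (m := m) (by simp [hz])
    refine ⟨y, hy0, fun j => ?_⟩
    have := hy j
    rw [Pi.neg_apply, neg_lie, neg_eq_iff_eq_neg, ← neg_smul] at this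
    rw [this, hz]
    congr 1
    push_cast
    simp
    ring

end IsChevalleySystem

/-! ### The presentation and roots of `E₁₀` -/

namespace ETen

/-- The Chevalley generators of the positive part. -/
noncomputable def E (i : Fin 10) : Algebra :=
  (LieSubmodule.Quotient.mk (FreeLieAlgebra.of ℂ (CartanMatrix.Generators.E i)) :
    FreeLieAlgebra ℂ (CartanMatrix.Generators (Fin 10)) ⧸
      CartanMatrix.Relations.toIdeal ℂ cartanMatrix)

/-- The Chevalley generators of the negative part. -/
noncomputable def F (i : Fin 10) : Algebra :=
  (LieSubmodule.Quotient.mk (FreeLieAlgebra.of ℂ (CartanMatrix.Generators.F i)) :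
    FreeLieAlgebra ℂ (CartanMatrix.Generators (Fin 10)) ⧸
      CartanMatrix.Relations.toIdeal ℂ cartanMatrix)

/-- The projection of the free Lie algebra onto `E₁₀`. -/
noncomputable def proj : FreeLieAlgebra ℂ (CartanMatrix.Generators (Fin 10)) →ₗ⁅ℂ⁆ Algebra :=
  { ((LieSubmodule.Quotient.mk' (CartanMatrix.Relations.toIdeal ℂ cartanMatrix)).toLinearMap :
      FreeLieAlgebra ℂ (CartanMatrix.Generators (Fin 10)) →ₗ[ℂ] _) with
    map_lie' := fun {x y} => LieSubmodule.Quotient.mk_bracket _ x y }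

theorem proj_surjective : Function.Surjective proj :=
  LieSubmodule.Quotient.surjective_mk' (CartanMatrix.Relations.toIdeal ℂ cartanMatrix)

theorem proj_H (i : Fin 10) : proj (FreeLieAlgebra.of ℂ (.H i)) = H i := rfl
theorem proj_E (i : Fin 10) : proj (FreeLieAlgebra.of ℂ (.E i)) = E i := rfl
theorem proj_F (i : Fin 10) : proj (FreeLieAlgebra.of ℂ (.F i)) = F i := rfl

theorem proj_eq_zero {x : FreeLieAlgebra ℂ (CartanMatrix.Generators (Fin 10))}
    (hx : x ∈ CartanMatrix.Relations.toSet ℂ cartanMatrix) : proj x = 0 :=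
  (LieSubmodule.Quotient.mk_eq_zero (N := CartanMatrix.Relations.toIdeal ℂ cartanMatrix)).2
    (LieSubmodule.subset_lieSpan hx)

theorem proj_ad_pow (x y : FreeLieAlgebra ℂ (CartanMatrix.Generators (Fin 10))) (n : ℕ) :
    proj ((LieAlgebra.ad ℂ _ x ^ n) y) = (LieAlgebra.ad ℂ _ (proj x) ^ n) (proj y) := by
  induction n with
  | zero => simp
  | succ n ih => simp [pow_succ', ih]

theorem isChevalleySystem : IsChevalleySystem ℂ cartanMatrix H E F where
  lie_h_h i j := by
    have := proj_eq_zero (x := CartanMatrix.Relations.HH ℂ (i, j))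
      (by simp [CartanMatrix.Relations.toSet])
    simpa [CartanMatrix.Relations.HH, proj_H] using this
  lie_e_f i j := by
    have := proj_eq_zero (x := CartanMatrix.Relations.EF ℂ (i, j))
      (by simp [CartanMatrix.Relations.toSet])
    by_cases hij : i = j
    · subst hij
      simpa [CartanMatrix.Relations.EF, proj_H, proj_E, proj_F, sub_eq_zero] using this
    · simpa [CartanMatrix.Relations.EF, proj_E, proj_F, hij] using this
  lie_h_e i j := by
    have := proj_eq_zero (x := CartanMatrix.Relations.HE ℂ cartanMatrix (i, j))
      (by simp [CartanMatrix.Relations.toSet])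
    rw [Int.cast_smul_eq_zsmul]
    simpa [CartanMatrix.Relations.HE, proj_H, proj_E, sub_eq_zero] using this
  lie_h_f i j := by
    have := proj_eq_zero (x := CartanMatrix.Relations.HF ℂ cartanMatrix (i, j))
      (by simp [CartanMatrix.Relations.toSet])
    rw [Int.cast_smul_eq_zsmul, ← add_eq_zero_iff_eq_neg]
    simpa [CartanMatrix.Relations.HF, proj_H, proj_F] using this
  serre_e i j := by
    have := proj_eq_zero (x := CartanMatrix.Relations.adE ℂ cartanMatrix (i, j))
      (by simp [CartanMatrix.Relations.toSet])
    -- The relation applies the power to `⁅E i, E j⁆`, which accounts for the extra `1`.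
    refine ⟨(-cartanMatrix i j).toNat + 1, ?_⟩
    rw [pow_succ, Module.End.mul_apply, LieAlgebra.ad_apply, ← proj_E, ← proj_E,
      ← LieHom.map_lie, ← proj_ad_pow]
    exact this
  serre_f i j := by
    have := proj_eq_zero (x := CartanMatrix.Relations.adF ℂ cartanMatrix (i, j))
      (by simp [CartanMatrix.Relations.toSet])
    refine ⟨(-cartanMatrix i j).toNat + 1, ?_⟩
    rw [pow_succ, Module.End.mul_apply, LieAlgebra.ad_apply, ← proj_F, ← proj_F,
      ← LieHom.map_lie, ← proj_ad_pow]
    exact this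
  eq_top_of_mem K hh he hf := by
    let φ : CartanMatrix.Generators (Fin 10) → K
      | .H i => ⟨H i, hh i⟩
      | .E i => ⟨E i, he i⟩
      | .F i => ⟨F i, hf i⟩
    have hφ : K.incl.comp (FreeLieAlgebra.lift ℂ φ) = proj := by
      refine FreeLieAlgebra.hom_ext ?_
      rintro (i | i | i) <;> simp [FreeLieAlgebra.lift_of_apply, φ, proj_H, proj_E, proj_F]
    refine eq_top_iff.2 fun x _ => ?_
    obtain ⟨y, rfl⟩ := proj_surjective x
    rw [← hφ]
    exact (FreeLieAlgebra.lift ℂ φ y).2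

theorem cartanMatrix_self (i : Fin 10) : cartanMatrix i i = 2 := by
  exact_mod_cast (coroot_simpleRoot i i).symm.trans (coroot_simpleRoot_self i)

/-- The simple coroots separate the points of the dual of the Cartan subalgebra. -/
theorem eq_of_coroot_eq {α β : CartanDual} (h : ∀ i, coroot i α = coroot i β) : α = β := by
  have h' (i : Fin 10) : coroot i (α - β) = 0 := by rw [map_sub, h, sub_self]
  rw [← sub_eq_zero]
  generalize α - β = γ at h'
  have h0 := h' 0
  have h1 := h' 1
  have h2 := h' 2
  have h3 := h' 3
  have h4 := h' 4
  have h5 := h' 5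
  have h6 := h' 6
  have h7 := h' 7
  have h8 := h' 8
  have h9 := h' 9
  simp [coroot, corootVec, dotProduct, Fin.sum_univ_succ, Fin.succ] at h0 h1 h2 h3 h4 h5 h6 h7 h8 h9
  funext i
  fin_cases i <;> simp <;> linarith

theorem coroot_sum (k : Fin 10 → ℕ) (i : Fin 10) :
    coroot i (∑ j, (k j : ℝ) • simpleRoot j) = ∑ j, (k j : ℝ) * (cartanMatrix i j : ℝ) := by
  simp [coroot_simpleRoot]

/-- A root is, up to sign, a combination of simple roots with natural coefficients, and is simple
if it is a multiple of a simple root. -/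
theorem IsRoot.exists_eq_sum {α : CartanDual} (hα : IsRoot α) :
    ∃ k : Fin 10 → ℕ, ((∃ j, k = Pi.single j 1) ∨ ∃ i j, i ≠ j ∧ k i ≠ 0 ∧ k j ≠ 0) ∧
      (α = ∑ j, (k j : ℝ) • simpleRoot j ∨ α = -∑ j, (k j : ℝ) • simpleRoot j) := by
  obtain ⟨hα0, x, hx0, hx⟩ := hα
  obtain ⟨k, hk, h⟩ := isChevalleySystem.exists_eq_sum_of_weight
    (χ := fun i => ((coroot i α : ℝ) : ℂ))
    (fun h0 => hα0 (eq_of_coroot_eq fun i => by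
      rw [map_zero]; exact Complex.ofReal_eq_zero.1 (congrFun h0 i))) hx0 hx
  refine ⟨k, hk, h.imp (fun h => ?_) fun h => ?_⟩
  · refine eq_of_coroot_eq fun i => ?_
    rw [coroot_sum]
    exact_mod_cast h i
  · refine eq_of_coroot_eq fun i => ?_
    rw [map_neg, coroot_sum]
    exact_mod_cast h i

theorem IsRoot.exists_coroot_eq_intCast {α : CartanDual} (hα : IsRoot α) (i : Fin 10) :
    ∃ z : ℤ, coroot i α = z := by
  obtain ⟨k, -, rfl | rfl⟩ := hα.exists_eq_sum
  · exact ⟨∑ j, k j * cartanMatrix i j, by rw [coroot_sum]; push_cast; rfl⟩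
  · exact ⟨-∑ j, k j * cartanMatrix i j, by rw [map_neg, coroot_sum]; push_cast; rfl⟩

theorem simpleReflection_apply (i : Fin 10) (α : CartanDual) :
    simpleReflection i α = α - coroot i α • simpleRoot i :=
  Module.reflection_apply _ _

theorem IsRoot.simpleReflection {α : CartanDual} (hα : IsRoot α) (i : Fin 10) :
    IsRoot (simpleReflection i α) := by
  obtain ⟨z, hz⟩ := hα.exists_coroot_eq_intCast i
  obtain ⟨hα0, x, hx0, hx⟩ := hα
  refine ⟨fun h => hα0 ((LinearEquiv.map_eq_zero_iff _).1 h), ?_⟩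
  obtain ⟨y, hy0, hy⟩ := isChevalleySystem.exists_weight_reflection (cartanMatrix_self i) hx0 hx
    (z := z) (by rw [hz]; norm_cast)
  refine ⟨y, hy0, fun j => ?_⟩
  rw [hy, simpleReflection_apply, map_sub, map_smul, coroot_simpleRoot]
  simp

/-! ### Coordinate permutations in the Weyl group -/

/-- Permutation of the coordinates of the physical basis. -/
def permute (σ : Equiv.Perm (Fin 10)) : CartanDual ≃ₗ[ℝ] CartanDual :=
  LinearEquiv.funCongrLeft ℝ ℝ σ

theorem permute_apply (σ : Equiv.Perm (Fin 10)) (α : CartanDual) : permute σ α = α ∘ σ := rfl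

theorem simpleReflection_castSucc (i : Fin 9) :
    simpleReflection i.castSucc = permute (Equiv.swap i.castSucc i.succ) := by
  refine LinearEquiv.ext fun α => funext fun j => ?_
  rw [simpleReflection_apply, permute_apply]
  fin_cases i <;> fin_cases j <;>
    simp [coroot, corootVec, simpleRoot, dotProduct, Fin.sum_univ_succ, Fin.succ,
      Equiv.swap_apply_def]

theorem permute_mem_weylGroup (σ : Equiv.Perm (Fin 10)) : permute σ ∈ weylGroup := by
  have hσ : σ ∈ Submonoid.closure
      (Set.range fun i : Fin 9 => Equiv.swap i.castSucc i.succ) := by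
    rw [Equiv.Perm.mclosure_swap_castSucc_succ]
    trivial
  induction hσ using Submonoid.closure_induction with
  | mem σ hσ =>
    obtain ⟨i, rfl⟩ := hσ
    simp only
    rw [← simpleReflection_castSucc]
    exact Subgroup.subset_closure ⟨_, rfl⟩
  | one => exact one_mem weylGroup
  -- Precomposition reverses products.
  | mul σ τ _ _ hσ hτ => exact mul_mem hτ hσ

theorem IsRoot.permute {α : CartanDual} (hα : IsRoot α) (σ : Equiv.Perm (Fin 10)) :
    IsRoot (permute σ α) := by
  have hσ : σ ∈ Submonoid.closure
      (Set.range fun i : Fin 9 => Equiv.swap i.castSucc i.succ) := by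
    rw [Equiv.Perm.mclosure_swap_castSucc_succ]
    trivial
  induction hσ using Submonoid.closure_induction generalizing α with
  | mem σ hσ =>
    obtain ⟨i, rfl⟩ := hσ
    simp only
    rw [← simpleReflection_castSucc]
    exact hα.simpleReflection _
  | one => exact hα
  | mul σ τ _ _ hσ hτ => exact hτ (hσ hα)

/-! ### Sign constraints and negative coordinates -/

/-- The coordinates of a combination of simple roots which determine its coefficients. -/
theorem coordinates_sum (k : Fin 10 → ℕ) {α : CartanDual}
    (hα : α = ∑ j, (k j : ℝ) • simpleRoot j) :
    α 0 = k 0 ∧ α 0 + α 1 = k 1 ∧ α 0 + α 1 + α 2 = k 2 ∧ ∑ i, α i = 3 * k 9 := by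
  subst hα
  refine ⟨?_, ?_, ?_, ?_⟩ <;>
    simp [simpleRoot, Fin.sum_univ_succ, Fin.succ]
  ring

theorem IsRoot.nonneg_or_nonpos {α : CartanDual} (hα : IsRoot α) :
    (0 ≤ α 0 ∧ 0 ≤ α 0 + α 1 ∧ 0 ≤ α 0 + α 1 + α 2 ∧ 0 ≤ ∑ i, α i) ∨
      (α 0 ≤ 0 ∧ α 0 + α 1 ≤ 0 ∧ α 0 + α 1 + α 2 ≤ 0 ∧ ∑ i, α i ≤ 0) := by
  obtain ⟨k, -, h | h⟩ := hα.exists_eq_sum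
  · obtain ⟨h0, h1, h2, h3⟩ := coordinates_sum k h
    left
    rw [h2, h1, h0, h3]
    refine ⟨?_, ?_, ?_, ?_⟩ <;> positivity
  · obtain ⟨h0, h1, h2, h3⟩ := coordinates_sum k (α := -α) (by rw [h, neg_neg])
    right
    simp only [Pi.neg_apply, Finset.sum_neg_distrib] at h0 h1 h2 h3
    refine ⟨?_, ?_, ?_, ?_⟩ <;> linarith [(k 0).cast_nonneg (α := ℝ),
      (k 1).cast_nonneg (α := ℝ), (k 2).cast_nonneg (α := ℝ), (k 9).cast_nonneg (α := ℝ)]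

theorem sum_permute (σ : Equiv.Perm (Fin 10)) (α : CartanDual) :
    ∑ i, permute σ α i = ∑ i, α i :=
  Equiv.sum_comp σ α

/-- Three-transitivity of the symmetric group moves any three positions to the front. -/
theorem exists_perm_apply_eq {p q l : Fin 10} (hpq : p ≠ q) (hpl : p ≠ l) (hql : q ≠ l) :
    ∃ σ : Equiv.Perm (Fin 10), σ 0 = p ∧ σ 1 = q ∧ σ 2 = l := by
  have hu : Function.Injective ![(0 : Fin 10), 1, 2] := by decide
  have hv : Function.Injective ![p, q, l] := by
    intro a b
    fin_cases a <;> fin_cases b <;> simp [hpq, hpl, hql, hpq.symm, hpl.symm, hql.symm]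
  have := Equiv.Perm.isMultiplyPretransitive (Fin 10) 3
  obtain ⟨σ, hσ⟩ := MulAction.exists_smul_eq (Equiv.Perm (Fin 10))
    (⟨_, hu⟩ : Fin 3 ↪ Fin 10) ⟨_, hv⟩
  exact ⟨σ, DFunLike.congr_fun hσ 0, DFunLike.congr_fun hσ 1, DFunLike.congr_fun hσ 2⟩

theorem IsRoot.nonneg_or_nonpos_of_ne {α : CartanDual} (hα : IsRoot α) {p q l : Fin 10}
    (hpq : p ≠ q) (hpl : p ≠ l) (hql : q ≠ l) :
    (0 ≤ α p ∧ 0 ≤ α p + α q ∧ 0 ≤ α p + α q + α l ∧ 0 ≤ ∑ i, α i) ∨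
      (α p ≤ 0 ∧ α p + α q ≤ 0 ∧ α p + α q + α l ≤ 0 ∧ ∑ i, α i ≤ 0) := by
  obtain ⟨σ, rfl, rfl, rfl⟩ := exists_perm_apply_eq hpq hpl hql
  have := (hα.permute σ).nonneg_or_nonpos
  rwa [sum_permute] at this

/-- If a multiple of the first simple root is a root, the coefficient is `±1`. -/
theorem IsRoot.eq_one_of_smul {a : ℝ} (ha : 0 < a) (h : IsRoot (a • simpleRoot 0)) : a = 1 := by
  obtain ⟨k, hk, hs⟩ := h.exists_eq_sum
  have key (c : ℝ) (hc : c • simpleRoot 0 = ∑ j, (k j : ℝ) • simpleRoot j) :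
      c = k 0 ∧ ∀ j, j ≠ 0 → k j = 0 := by
    have hcoord (i : Fin 10) := congrFun hc i
    have h0 := hcoord 0
    have h1 := hcoord 1
    have h2 := hcoord 2
    have h3 := hcoord 3
    have h4 := hcoord 4
    have h5 := hcoord 5
    have h6 := hcoord 6
    have h7 := hcoord 7
    have h8 := hcoord 8
    have h9 := hcoord 9
    simp [simpleRoot, Fin.sum_univ_succ, Fin.succ] at h0 h1 h2 h3 h4 h5 h6 h7 h8 h9
    refine ⟨h0, fun j hj => ?_⟩
    have : (k j : ℝ) = 0 := by
      fin_cases j <;> first | exact absurd rfl hj | (simp; rw [← Nat.cast_eq_zero (R := ℝ)]; linarith)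
    exact_mod_cast this
  -- Only the first coefficient survives, which rules out two nonzero coefficients and leaves a
  -- single simple root.
  have hk0 (hz : ∀ j, j ≠ 0 → k j = 0) : k 0 = 1 := by
    rcases hk with ⟨j, rfl⟩ | ⟨i, j, hij, hi, hj⟩
    · by_cases hj : j = 0
      · simp [hj]
      · simpa using hz j hj
    · exact absurd (not_imp_comm.1 (hz i) hi) fun hi0 =>
        hij (hi0.trans (not_imp_comm.1 (hz j) hj).symm)
  rcases hs with hs | hs
  · obtain ⟨h1, h2⟩ := key a hs
    rw [h1, hk0 h2, Nat.cast_one]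
  · obtain ⟨h1, -⟩ := key (-a) (by rw [neg_smul, hs, neg_neg])
    linarith [(k 0).cast_nonneg (α := ℝ)]

/-- A positive root with a negative coordinate is a permutation of the first simple root. -/
theorem IsPositiveRoot.exists_permute_eq {α : CartanDual} (hα : IsPositiveRoot α) {p : Fin 10}
    (hp : α p < 0) : ∃ σ : Equiv.Perm (Fin 10), permute σ α = simpleRoot 0 := by
  obtain ⟨hr, k, hk⟩ := hα
  have hlevel : 0 ≤ ∑ i, α i := by
    rw [(coordinates_sum k hk).2.2.2]
    positivity
  have hsum : ∑ i, α i = 0 := by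
    obtain ⟨q, l, hpq, hpl, hql⟩ : ∃ q l : Fin 10, p ≠ q ∧ p ≠ l ∧ q ≠ l := by
      clear hp
      revert p; decide
    rcases hr.nonneg_or_nonpos_of_ne hpq hpl hql with h | h <;> linarith [h.1, h.2.2.2]
  obtain ⟨q, hq⟩ : ∃ q, 0 < α q := by
    by_contra! hcon
    exact (Finset.sum_neg' (fun i _ => hcon i) ⟨p, Finset.mem_univ p, hp⟩).ne hsum
  have hqp : q ≠ p := by rintro rfl; linarith
  -- The order `q, p, l` starts with a positive entry, so its partial sums are nonnegative; `p, q,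
  -- l` starts with a negative one, so the same sums are nonpositive.
  have hothers (l : Fin 10) (hlp : l ≠ p) (hlq : l ≠ q) : α p + α q = 0 ∧ α l = 0 := by
    rcases hr.nonneg_or_nonpos_of_ne hqp hlq.symm hlp.symm with h | h <;>
      rcases hr.nonneg_or_nonpos_of_ne hqp.symm hlp.symm hlq.symm with h' | h' <;>
      constructor <;> linarith [h.1, h'.1, h.2.1, h'.2.1, h.2.2.1, h'.2.2.1]
  obtain ⟨l, hlp, hlq⟩ : ∃ l : Fin 10, l ≠ p ∧ l ≠ q := by
    clear * -
    revert p q; decide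
  obtain ⟨σ, h0, h1, -⟩ := exists_perm_apply_eq hqp hlq.symm hlp.symm
  have heq : permute σ α = α q • simpleRoot 0 := by
    funext i
    rw [permute_apply, Function.comp_apply]
    by_cases hi0 : i = 0
    · subst hi0; simp [h0, simpleRoot]
    by_cases hi1 : i = 1
    · subst hi1
      have := (hothers l hlp hlq).1
      simp [h1, simpleRoot]
      linarith
    · rw [(hothers (σ i) (by rw [← h1]; exact σ.injective.ne hi1)
        (by rw [← h0]; exact σ.injective.ne hi0)).2]
      fin_cases i <;> first | exact absurd rfl hi0 | exact absurd rfl hi1 | simp [simpleRoot]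
  refine ⟨σ, ?_⟩
  have hone : α q = 1 := IsRoot.eq_one_of_smul hq (heq ▸ hr.permute σ)
  rw [heq, hone, one_smul]

end ETen

theorem mainTheorem4 :
    (∀ n : ETen.CartanDual, ETen.IsPositiveRoot n → ETen.IsImaginaryRoot n → ∀ i, 0 ≤ n i) ∧
    (∀ n : ETen.CartanDual, ETen.IsPositiveRoot n → ETen.IsRealRoot n → (∃ i, n i < 0) →
      ∃ σ : Equiv.Perm (Fin 10), n = ![1, -1, 0, 0, 0, 0, 0, 0, 0, 0] ∘ σ) := by
  refine ⟨fun n hn him i => ?_, fun n hn _ ⟨i, hi⟩ => ?_⟩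
  · by_contra! hi
    obtain ⟨σ, hσ⟩ := hn.exists_permute_eq hi
    -- A negative coordinate would make the root Weyl-conjugate to a simple root, hence real.
    exact him.2 ⟨hn.1, ETen.permute σ, ETen.permute_mem_weylGroup σ, 0, hσ⟩
  · obtain ⟨σ, hσ⟩ := hn.exists_permute_eq hi
    refine ⟨σ.symm, funext fun j => ?_⟩
    have := congrFun hσ (σ.symm j)
    rw [ETen.permute_apply, Function.comp_apply, Equiv.apply_symm_apply] at this
    exact this
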